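/- Let $\theta_{3,4}$ be the graph consisting of three internally disjoint paths of length $4$ (four edges each), all having the same two endpoints. For positive integers $r,k$, an $(r,k)$-graph is a graph whose vertex set can be partitioned into $r$ nonempty parts, each of size at most $k$, such that there is at least one edge between any two distinct parts. For a graph $H$, let $f(r,H)$ be the minimum $k$ for which there exists an $(r,k)$-graph containing no (not necessarily induced) subgraph isomorphic to $H$. Then there are constants $c, C > 0$ such that for every integer $r \ge 1$, $$c\, r^{3/5} < f(r, \theta_{3,4}) < C\, r^{3/5}.$$ -/

import Mathlib

/-- The relation generating `thetaGraph`: the vertices `Sum.inl false` and `Sum.inl true` are the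
two common endpoints, and `Sum.inr (i, 0), …, Sum.inr (i, ℓ - 2)` are the `ℓ - 1` internal vertices
of the `i`-th path, in the order in which the path runs from `Sum.inl false` to `Sum.inl true`. -/
def thetaStep (K ℓ : ℕ) : Bool ⊕ Fin K × Fin (ℓ - 1) → Bool ⊕ Fin K × Fin (ℓ - 1) → Prop
  | Sum.inl false, Sum.inr (_, j) => j.val = 0
  | Sum.inr (i, j), Sum.inr (i', j') => i = i' ∧ j.val + 1 = j'.val
  | Sum.inr (_, j), Sum.inl true => j.val + 2 = ℓ
  | _, _ => False

/-- The theta graph `θ_{K,ℓ}` (for `K, ℓ ≥ 2`): `K` internally disjoint paths of length `ℓ` (that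
is, with `ℓ` edges), all having the same two vertices as endpoints. -/
def thetaGraph (K ℓ : ℕ) : SimpleGraph (Bool ⊕ Fin K × Fin (ℓ - 1)) :=
  SimpleGraph.fromRel (thetaStep K ℓ)

/-- `G` is an `(r, k)`-graph: its vertex set is partitioned into `r` (nonempty) parts of size at
most `k`, with at least one edge between any two distinct parts. In particular `G` is finite. -/
def IsRKGraph {V : Type*} (G : SimpleGraph V) (r k : ℕ) : Prop :=
  ∃ P : Fin r → Set V,
    (∀ i, (P i).Nonempty) ∧
    (∀ i j, i ≠ j → Disjoint (P i) (P j)) ∧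
    (⋃ i, P i) = Set.univ ∧
    (∀ i, (P i).encard ≤ k) ∧
    ∀ i j, i ≠ j → ∃ x ∈ P i, ∃ y ∈ P j, G.Adj x y

/-- `f(r, H)`: the minimum `k` for which there is an `H`-free `(r, k)`-graph, where `H`-free means
having no subgraph (not necessarily induced) isomorphic to `H`. As `(r, k)`-graphs are finite,
vertex types in `Type` cover all of them. (The value is `0` if there is no such `k`; for `r ≥ 1`
the value is positive otherwise, because parts are nonempty.) -/
noncomputable def minSplit {W : Type*} (r : ℕ) (H : SimpleGraph W) : ℕ :=
  sInf {k : ℕ | ∃ (V : Type) (G : SimpleGraph V), H.Free G ∧ IsRKGraph G r k}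

/-! Upper bound. Let K be the field with p² elements, p an odd prime, and join points (a, b, c, d)
to lines (w, x, y, z) by the equations of `Incident`. Eliminating along a path of length four turns
three such paths with common ends into three roots of a quadratic, which excludes θ_{3,4}
(`Incident.false_of_theta`). The p⁸ points and p⁸ lines fall into p⁵ parts of size 2p³: fix a, d and
half of c for points, and w, x and half of y for lines. The free coordinates solve the incidence
equations for any two parts (`exists_splitGraph_adj`). With p of order r^(1/5), the part size has
order r^(3/5).

Lower bound. This is the Faudree–Simonovits argument. Without θ_{3,4}, the first distance levels
from a vertex span only linearly many edges among themselves and with the next level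
(`adjCount_distLevel_le`). With minimum degree δ the levels must therefore grow by a factor of order
δ, and four levels give δ⁴ = O(n) (`pow_four_le_card_of_minDegree`). An (r, k)-graph has at most rk
vertices and at least r(r - 1) ordered adjacent pairs, so δ of order r/k is available in a subgraph.
Then (r/k)⁴ = O(rk), that is, r³ = O(k⁵) (`IsRKGraph.pow_three_le`). -/

/-! ### Copies of θ_{3,4} as explicit vertex families -/

/-- `a i`, `b i`, `c i` (`i : Fin 3`) are the inner vertices of three internally disjoint paths of
length four from `s` to `t`. -/
structure IsTheta {V : Type*} (G : SimpleGraph V) (s t : V) (a b c : Fin 3 → V) : Prop where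
  sa : ∀ i, G.Adj s (a i)
  ab : ∀ i, G.Adj (a i) (b i)
  bc : ∀ i, G.Adj (b i) (c i)
  ct : ∀ i, G.Adj (c i) t
  a_inj : Function.Injective a
  b_inj : Function.Injective b
  c_inj : Function.Injective c
  s_ne_t : s ≠ t
  a_ne_t : ∀ i, a i ≠ t
  b_ne_s : ∀ i, b i ≠ s
  b_ne_t : ∀ i, b i ≠ t
  c_ne_s : ∀ i, c i ≠ s
  a_ne_b : ∀ i j, a i ≠ b j
  a_ne_c : ∀ i j, a i ≠ c j
  b_ne_c : ∀ i j, b i ≠ c j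

/-- The vertex map of the copy of `θ_{3,4}` with the given vertices. -/
def thetaVertex {V : Type*} (s t : V) (a b c : Fin 3 → V) : Bool ⊕ Fin 3 × Fin 3 → V
  | Sum.inl x => if x then t else s
  | Sum.inr (i, j) => ![a i, b i, c i] j

theorem IsTheta.injective {V : Type*} {G : SimpleGraph V} {s t : V} {a b c : Fin 3 → V}
    (h : IsTheta G s t a b c) : Function.Injective (thetaVertex s t a b c) := by
  have sa := fun i => (h.sa i).ne
  have ct := fun i => (h.ct i).ne
  obtain ⟨-, -, -, -, ha, hb, hc, h1, h2, h3, h4, h5, h6, h7, h8⟩ := h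
  rintro (x | ⟨i, j⟩) (y | ⟨k, l⟩) e
  · cases x <;> cases y <;> simp_all [thetaVertex]
  · cases x <;> fin_cases l <;> simp [thetaVertex] at e <;> grind
  · cases y <;> fin_cases j <;> simp [thetaVertex] at e <;> grind
  · fin_cases j <;> fin_cases l <;> simp [thetaVertex] at e <;>
      first | rw [ha e] | rw [hb e] | rw [hc e] | grind

theorem IsTheta.isContained {V : Type*} {G : SimpleGraph V} {s t : V} {a b c : Fin 3 → V}
    (h : IsTheta G s t a b c) : (thetaGraph 3 4).IsContained G := by
  have key : ∀ x y, thetaStep 3 4 x y →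
      G.Adj (thetaVertex s t a b c x) (thetaVertex s t a b c y) := by
    rintro ((_ | _) | ⟨i, j⟩) ((_ | _) | ⟨k, l⟩) hxy <;> simp only [thetaStep] at hxy
    · change Fin 3 at l
      fin_cases l <;> simp at hxy
      exact h.sa _
    · change Fin 3 at j
      fin_cases j <;> simp at hxy
      exact h.ct _
    · obtain ⟨rfl, hxy⟩ := hxy
      change Fin 3 at j l
      fin_cases j <;> fin_cases l <;> simp at hxy
      · exact h.ab _
      · exact h.bc _
  refine ⟨⟨⟨thetaVertex s t a b c, ?_⟩, h.injective⟩⟩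
  intro x y hxy
  rw [thetaGraph, SimpleGraph.fromRel_adj] at hxy
  rcases hxy.2 with h1 | h1
  · exact key _ _ h1
  · exact (key _ _ h1).symm

theorem exists_isTheta_of_isContained {V : Type*} {G : SimpleGraph V}
    (h : (thetaGraph 3 4).IsContained G) : ∃ s t a b c, IsTheta G s t a b c := by
  obtain ⟨f⟩ := h
  have inj : Function.Injective f := f.injective
  have adj : ∀ x y, x ≠ y → thetaStep 3 4 x y → G.Adj (f x) (f y) := by
    intro x y hne hs
    exact f.toHom.map_adj (by rw [thetaGraph, SimpleGraph.fromRel_adj]; exact ⟨hne, Or.inl hs⟩)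
  refine ⟨f (Sum.inl false), f (Sum.inl true), fun i => f (Sum.inr (i, (0 : Fin 3))),
    fun i => f (Sum.inr (i, (1 : Fin 3))), fun i => f (Sum.inr (i, (2 : Fin 3))), ?_⟩
  constructor
  iterate 4 (intro i; exact adj _ _ (by simp) (by simp [thetaStep]))
  iterate 3 (intro i j e; simpa using inj e)
  · intro e
    simpa using inj e
  iterate 4 (intro i e; simpa using inj e)
  iterate 3 (intro i j e; simpa using inj e)

/-! ### The algebra of paths of length four -/

/-- A quadratic polynomial with three distinct roots vanishes identically. -/
theorem quadratic_eq_zero {K : Type*} [Field K] {α β γ x y z : K} (hxy : x ≠ y) (hxz : x ≠ z)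
    (hyz : y ≠ z) (hx : α * x ^ 2 + β * x + γ = 0) (hy : α * y ^ 2 + β * y + γ = 0)
    (hz : α * z ^ 2 + β * z + γ = 0) : α = 0 ∧ β = 0 ∧ γ = 0 := by
  have h1 : α * (x + y) + β = 0 := by
    apply mul_left_cancel₀ (sub_ne_zero.2 hxy)
    linear_combination hx - hy
  have h2 : α * (x + z) + β = 0 := by
    apply mul_left_cancel₀ (sub_ne_zero.2 hxz)
    linear_combination hx - hz
  have ha : α = 0 := by
    apply mul_left_cancel₀ (sub_ne_zero.2 hyz)
    linear_combination h1 - h2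
  subst ha
  have hb : β = 0 := by linear_combination h1
  subst hb
  exact ⟨rfl, rfl, by linear_combination hx⟩

/-- Given the two ends `a ≠ a'`, three paths of length four with the same displacements `t₁`, `t₂`,
`t₃` cannot have distinct middle vertices. -/
theorem false_of_three_middles {K : Type*} [Field K] {a a' t₁ t₂ t₃ : K} {w b w' : Fin 3 → K}
    (haa : a ≠ a') (hab : ∀ i, a ≠ b i) (hba : ∀ i, b i ≠ a') (hww : ∀ i, w i ≠ w' i)
    (hw : Function.Injective w)
    (h₁ : ∀ i, (a - b i) * w i + (b i - a') * w' i = t₁)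
    (h₂ : ∀ i, (a ^ 2 - b i ^ 2) * w i + (b i ^ 2 - a' ^ 2) * w' i = t₂)
    (h₃ : ∀ i, (a - b i) * w i ^ 2 + (b i - a') * w' i ^ 2 = t₃) : False := by
  have e₁ : ∀ i, (a - b i) * w i * (a - a') = t₂ - (b i + a') * t₁ := fun i => by
    linear_combination h₂ i - (b i + a') * h₁ i
  have e₂ : ∀ i, (b i - a') * w' i * (a - a') = (a + b i) * t₁ - t₂ := fun i => by
    linear_combination (a + b i) * h₁ i - h₂ i
  -- By `e₁`, the value `b i` determines `w i`.
  have hb : Function.Injective b := by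
    intro i j hij
    apply hw
    apply mul_left_cancel₀ (mul_ne_zero (sub_ne_zero.2 (hab i)) (sub_ne_zero.2 haa))
    have := e₁ i
    have := e₁ j
    rw [← hij] at this
    linear_combination e₁ i - this
  have hq : ∀ i, (t₂ - (b i + a') * t₁) ^ 2 * (b i - a') + ((a + b i) * t₁ - t₂) ^ 2 * (a - b i)
      - t₃ * (a - a') ^ 2 * (a - b i) * (b i - a') = 0 := fun i => by
    rw [← e₁, ← e₂, ← h₃ i]
    ring
  -- The cubic terms t₁²x³ and -t₁²x³ cancel, so three roots suffice.
  obtain ⟨α, β, γ, hαβγ⟩ : ∃ α β γ : K, ∀ x,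
      (t₂ - (x + a') * t₁) ^ 2 * (x - a') + ((a + x) * t₁ - t₂) ^ 2 * (a - x)
      - t₃ * (a - a') ^ 2 * (a - x) * (x - a') = α * x ^ 2 + β * x + γ := by
    refine ⟨-2 * t₁ * (t₂ - a' * t₁) - a' * t₁ ^ 2 + a * t₁ ^ 2 - 2 * t₁ * (a * t₁ - t₂)
        + t₃ * (a - a') ^ 2,
      (t₂ - a' * t₁) ^ 2 + 2 * a' * t₁ * (t₂ - a' * t₁) - (a * t₁ - t₂) ^ 2
        + 2 * a * t₁ * (a * t₁ - t₂) - t₃ * (a - a') ^ 2 * (a + a'),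
      -a' * (t₂ - a' * t₁) ^ 2 + a * (a * t₁ - t₂) ^ 2 + t₃ * (a - a') ^ 2 * a * a', fun x => ?_⟩
    ring
  simp only [hαβγ] at hq
  obtain ⟨rfl, rfl, rfl⟩ := quadratic_eq_zero (hb.ne (by decide : (0 : Fin 3) ≠ 1))
    (hb.ne (by decide : (0 : Fin 3) ≠ 2)) (hb.ne (by decide : (1 : Fin 3) ≠ 2)) (hq 0) (hq 1) (hq 2)
  have hD : a - a' ≠ 0 := sub_ne_zero.2 haa
  -- Evaluating the zero polynomial at a leaves only the first square. The resulting relation makes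
  -- both `w 0` and `w' 0` equal to t₁ / (a - a').
  have ht : t₂ = (a + a') * t₁ := by
    have := hαβγ a
    have h0 : (t₂ - (a + a') * t₁) ^ 2 * (a - a') = 0 := by linear_combination this
    have := (mul_eq_zero.1 h0).resolve_right hD
    exact sub_eq_zero.1 (pow_eq_zero_iff (two_ne_zero)|>.1 this)
  apply hww 0
  apply mul_right_cancel₀ hD
  trans t₁
  · apply mul_left_cancel₀ (sub_ne_zero.2 (hab 0))
    linear_combination e₁ 0 + ht
  · apply mul_left_cancel₀ (sub_ne_zero.2 (hba 0))
    linear_combination - e₂ 0 + ht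

/-- The analogue of `false_of_three_middles` for coinciding ends; here two paths suffice. -/
theorem false_of_two_middles {K : Type*} [Field K] (h2 : (2 : K) ≠ 0) {a t₁ t₂ t₃ : K}
    {w b w' : Fin 3 → K}
    (hab : ∀ i, a ≠ b i) (hww : ∀ i, w i ≠ w' i) (hw : Function.Injective w)
    (h₁ : ∀ i, (a - b i) * w i + (b i - a) * w' i = t₁)
    (h₂ : ∀ i, (a ^ 2 - b i ^ 2) * w i + (b i ^ 2 - a ^ 2) * w' i = t₂)
    (h₃ : ∀ i, (a - b i) * w i ^ 2 + (b i - a) * w' i ^ 2 = t₃) : False := by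
  have ht : t₁ ≠ 0 := by
    rw [← h₁ 0, show (a - b 0) * w 0 + (b 0 - a) * w' 0 = (a - b 0) * (w 0 - w' 0) by ring]
    exact mul_ne_zero (sub_ne_zero.2 (hab 0)) (sub_ne_zero.2 (hww 0))
  have hb : b 0 = b 1 := by
    apply mul_right_cancel₀ ht
    have e : ∀ i, b i * t₁ = t₂ - a * t₁ := fun i => by rw [← h₁ i, ← h₂ i]; ring
    rw [e, e]
  have hs : w 0 + w' 0 = w 1 + w' 1 := by
    apply mul_right_cancel₀ ht
    have e : ∀ i, (w i + w' i) * t₁ = t₃ := fun i => by rw [← h₁ i, ← h₃ i]; ring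
    rw [e, e]
  have hd : w 0 - w' 0 = w 1 - w' 1 := by
    apply mul_left_cancel₀ (sub_ne_zero.2 (hab 0))
    have := h₁ 1
    rw [← hb] at this
    linear_combination h₁ 0 - this
  have : w 0 = w 1 := by
    apply mul_left_cancel₀ h2
    linear_combination hs + hd
  exact absurd (hw this) (by decide)

/-! ### The incidence graph and its θ_{3,4}-freeness -/

/-- The incidence relation between points `(a, b, c, d)` and lines `(w, x, y, z)`:
`b + x = a w`, `c + y = a² w` and `d + z = a w²`. -/
def Incident {K : Type*} [Field K] (p l : K × K × K × K) : Prop :=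
  p.2.1 + l.2.1 = p.1 * l.1 ∧ p.2.2.1 + l.2.2.1 = p.1 ^ 2 * l.1 ∧
    p.2.2.2 + l.2.2.2 = p.1 * l.1 ^ 2

/-- The polarity of the incidence relation `Incident`. -/
def swapCoord {K : Type*} (p : K × K × K × K) : K × K × K × K := (p.1, p.2.1, p.2.2.2, p.2.2.1)

theorem swapCoord_injective {K : Type*} : Function.Injective (swapCoord (K := K)) := by
  rintro ⟨a, b, c, d⟩ ⟨a', b', c', d'⟩ h
  simp only [swapCoord, Prod.mk.injEq] at h ⊢
  tauto

theorem Incident.swap {K : Type*} [Field K] {p l : K × K × K × K} (h : Incident p l) :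
    Incident (swapCoord l) (swapCoord p) := by
  obtain ⟨h1, h2, h3⟩ := h
  refine ⟨?_, ?_, ?_⟩ <;> simp only [swapCoord]
  · linear_combination h1
  · linear_combination h3
  · linear_combination h2

theorem Incident.left_ext {K : Type*} [Field K] {p p' l : K × K × K × K} (h : Incident p l)
    (h' : Incident p' l) (e : p.1 = p'.1) : p = p' := by
  obtain ⟨h1, h2, h3⟩ := h
  obtain ⟨h1', h2', h3'⟩ := h'
  rw [← e] at h1' h2' h3'
  refine Prod.ext e (Prod.ext ?_ (Prod.ext ?_ ?_))
  · linear_combination h1 - h1'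
  · linear_combination h2 - h2'
  · linear_combination h3 - h3'

theorem Incident.right_ext {K : Type*} [Field K] {p l l' : K × K × K × K} (h : Incident p l)
    (h' : Incident p l') (e : l.1 = l'.1) : l = l' :=
  swapCoord_injective (h.swap.left_ext h'.swap e)

/-- Alternating sums of the incidence equations along each path cancel all coordinates of the inner
vertices except the first ones, so the three paths share the displacements t₁, t₂, t₃ from s to t.
-/
theorem Incident.false_of_theta {K : Type*} [Field K] (h2 : (2 : K) ≠ 0) {s t : K × K × K × K}
    {A B C : Fin 3 → K × K × K × K} (hA : Function.Injective A)
    (hBs : ∀ i, B i ≠ s) (hBt : ∀ i, B i ≠ t) (hAC : ∀ i, A i ≠ C i)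
    (sA : ∀ i, Incident s (A i)) (BA : ∀ i, Incident (B i) (A i)) (BC : ∀ i, Incident (B i) (C i))
    (tC : ∀ i, Incident t (C i)) : False := by
  have hab : ∀ i, s.1 ≠ (B i).1 := fun i e => hBs i ((sA i).left_ext (BA i) e).symm
  have hba : ∀ i, (B i).1 ≠ t.1 := fun i e => hBt i ((BC i).left_ext (tC i) e)
  have hww : ∀ i, (A i).1 ≠ (C i).1 := fun i e => hAC i ((BA i).right_ext (BC i) e)
  have hw : Function.Injective fun i => (A i).1 := fun i j e => hA ((sA i).right_ext (sA j) e)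
  have h₁ : ∀ i, (s.1 - (B i).1) * (A i).1 + ((B i).1 - t.1) * (C i).1 = s.2.1 - t.2.1 :=
    fun i => by linear_combination (BA i).1 - (sA i).1 - (BC i).1 + (tC i).1
  have h₂ : ∀ i, (s.1 ^ 2 - (B i).1 ^ 2) * (A i).1 + ((B i).1 ^ 2 - t.1 ^ 2) * (C i).1 =
      s.2.2.1 - t.2.2.1 :=
    fun i => by linear_combination (BA i).2.1 - (sA i).2.1 - (BC i).2.1 + (tC i).2.1
  have h₃ : ∀ i, (s.1 - (B i).1) * (A i).1 ^ 2 + ((B i).1 - t.1) * (C i).1 ^ 2 =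
      s.2.2.2 - t.2.2.2 :=
    fun i => by linear_combination (BA i).2.2 - (sA i).2.2 - (BC i).2.2 + (tC i).2.2
  by_cases e : s.1 = t.1
  · rw [← e] at h₁ h₂ h₃
    exact false_of_two_middles h2 hab hww hw h₁ h₂ h₃
  · exact false_of_three_middles e hab hba hww hw h₁ h₂ h₃

/-- A bipartite graph of incidences between points and lines is `θ_{3,4}`-free. -/
theorem theta_free_of_incident {K V : Type*} [Field K] (h2 : (2 : K) ≠ 0) {G : SimpleGraph V}
    (side : V → Bool) (co : V → K × K × K × K)
    (inj : ∀ u v, side u = side v → co u = co v → u = v)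
    (adj : ∀ u v, G.Adj u v → side u = false → side v = true ∧ Incident (co u) (co v))
    (adj' : ∀ u v, G.Adj u v → side u = true → side v = false ∧ Incident (co v) (co u)) :
    (thetaGraph 3 4).Free G := by
  intro hG
  obtain ⟨s, t, a, b, c, h⟩ := exists_isTheta_of_isContained hG
  rcases hs : side s with _ | _
  · have ha := fun i => adj _ _ (h.sa i) hs
    have hb := fun i => adj' _ _ (h.ab i) (ha i).1
    have hc := fun i => adj _ _ (h.bc i) (hb i).1
    have ht := fun i => adj' _ _ (h.ct i) (hc i).1
    refine Incident.false_of_theta h2 (s := co s) (t := co t) (A := co ∘ a) (B := co ∘ b)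
      (C := co ∘ c) (fun i j e => h.a_inj (inj _ _ (by rw [(ha i).1, (ha j).1]) e))
      (fun i e => h.b_ne_s i (inj _ _ (by rw [(hb i).1, hs]) e))
      (fun i e => h.b_ne_t i (inj _ _ (by rw [(hb i).1, (ht i).1]) e))
      (fun i e => h.a_ne_c i i (inj _ _ (by rw [(ha i).1, (hc i).1]) e))
      (fun i => (ha i).2) (fun i => (hb i).2) (fun i => (hc i).2) (fun i => (ht i).2)
  · have ha := fun i => adj' _ _ (h.sa i) hs
    have hb := fun i => adj _ _ (h.ab i) (ha i).1
    have hc := fun i => adj' _ _ (h.bc i) (hb i).1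
    have ht := fun i => adj _ _ (h.ct i) (hc i).1
    -- Here the ends are lines; the polarity turns them into points.
    refine Incident.false_of_theta h2 (s := swapCoord (co s)) (t := swapCoord (co t))
      (A := swapCoord ∘ co ∘ a) (B := swapCoord ∘ co ∘ b) (C := swapCoord ∘ co ∘ c)
      (fun i j e => h.a_inj (inj _ _ (by rw [(ha i).1, (ha j).1]) (swapCoord_injective e)))
      (fun i e => h.b_ne_s i (inj _ _ (by rw [(hb i).1, hs]) (swapCoord_injective e)))
      (fun i e => h.b_ne_t i (inj _ _ (by rw [(hb i).1, (ht i).1]) (swapCoord_injective e)))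
      (fun i e => h.a_ne_c i i (inj _ _ (by rw [(ha i).1, (hc i).1]) (swapCoord_injective e)))
      (fun i => (ha i).2.swap) (fun i => (hb i).2.swap) (fun i => (hc i).2.swap)
      (fun i => (ht i).2.swap)

/-! ### Grouping points and lines into parts -/

/-- The coordinates of the points (`false`) and lines (`true`), grouped into parts indexed by `I`. -/
def splitCoord {K F I : Type*} (φ : K ≃ F × F) (e : I → K × F × K) :
    Bool × I × K × F → K × K × K × K
  | (false, i, x, g) => ((e i).1, x, φ.symm ((e i).2.1, g), (e i).2.2)
  | (true, i, x, g) => ((e i).1, (e i).2.2, φ.symm (g, (e i).2.1), x)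

theorem splitCoord_injective {K F I : Type*} {φ : K ≃ F × F} {e : I → K × F × K}
    (he : Function.Injective e) {u v : Bool × I × K × F} (hs : u.1 = v.1)
    (h : splitCoord φ e u = splitCoord φ e v) : u = v := by
  obtain ⟨s, i, x, g⟩ := u
  obtain ⟨s', i', x', g'⟩ := v
  obtain rfl : s = s' := hs
  cases s <;> simp only [splitCoord, Prod.mk.injEq, EmbeddingLike.apply_eq_iff_eq] at h
  · obtain ⟨h1, h2, ⟨h3, h4⟩, h5⟩ := h
    have := he (Prod.ext h1 (Prod.ext h3 h5))
    simp [*]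
  · obtain ⟨h1, h2, ⟨h3, h4⟩, h5⟩ := h
    have := he (Prod.ext h1 (Prod.ext h4 h2))
    simp [*]

/-- The incidence graph on the points and lines that lie in the parts indexed by `I`. -/
def splitGraph {K F I : Type*} [Field K] (φ : K ≃ F × F) (e : I → K × F × K) :
    SimpleGraph (Bool × I × K × F) where
  Adj u v := (u.1 = false ∧ v.1 = true ∧ Incident (splitCoord φ e u) (splitCoord φ e v)) ∨
    (u.1 = true ∧ v.1 = false ∧ Incident (splitCoord φ e v) (splitCoord φ e u))
  symm := ⟨fun u v h => by tauto⟩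
  loopless := ⟨fun u h => by
    rcases h with ⟨h, h', -⟩ | ⟨h, h', -⟩ <;> exact absurd (h.symm.trans h') (by decide)⟩

theorem splitGraph_free {K F I : Type*} [Field K] (h2 : (2 : K) ≠ 0) (φ : K ≃ F × F)
    {e : I → K × F × K} (he : Function.Injective e) : (thetaGraph 3 4).Free (splitGraph φ e) := by
  refine theta_free_of_incident h2 Prod.fst (splitCoord φ e)
    (fun u v hs h => splitCoord_injective he hs h) ?_ ?_
  · rintro u v (h | h) hu
    · exact h.2
    · simp [hu] at h
  · rintro u v (h | h) hu
    · simp [hu] at h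
    · exact h.2

/-- Each incidence equation has a free unknown: b in the first, z in the third. In the second, the
point part fixes the first half of c and the line part the second half of y, so the complementary
halves can be solved for separately. -/
theorem exists_splitGraph_adj {K F I : Type*} [Field K] [AddGroup F] (φ : K ≃+ F × F)
    (e : I → K × F × K) (i j : I) : ∃ x g y h,
      (splitGraph φ.toEquiv e).Adj (false, i, x, g) (true, j, y, h) := by
  obtain ⟨m, hm⟩ : ∃ m, m = φ ((e i).1 ^ 2 * (e j).1) := ⟨_, rfl⟩
  refine ⟨(e i).1 * (e j).1 - (e j).2.2, m.2 - (e j).2.1,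
    (e i).1 * (e j).1 ^ 2 - (e i).2.2, -(e i).2.1 + m.1, Or.inl ⟨rfl, rfl, ?_, ?_, ?_⟩⟩
  · simp [splitCoord]
  · change φ.symm _ + φ.symm _ = (e i).1 ^ 2 * (e j).1
    rw [← map_add, AddEquiv.symm_apply_eq, ← hm]
    simp
  · simp [splitCoord]

theorem exists_theta_free_isRKGraph {K F : Type} [Field K] [AddGroup F] [Finite F]
    (h2 : (2 : K) ≠ 0) (φ : K ≃+ F × F) {r : ℕ} (hr : r ≤ Nat.card F ^ 5) :
    ∃ (V : Type) (G : SimpleGraph V),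
      (thetaGraph 3 4).Free G ∧ IsRKGraph G r (2 * Nat.card F ^ 3) := by
  have : Finite K := Finite.of_equiv _ φ.toEquiv.symm
  have cK : Nat.card K = Nat.card F ^ 2 := by
    rw [Nat.card_congr φ.toEquiv, Nat.card_prod, sq]
  obtain ⟨e⟩ : Nonempty (Fin r ↪ K × F × K) := by
    have := Fintype.ofFinite (K × F × K)
    apply Function.Embedding.nonempty_of_card_le
    rw [Fintype.card_fin, ← Nat.card_eq_fintype_card, Nat.card_prod, Nat.card_prod, cK]
    exact hr.trans (le_of_eq (by ring))
  refine ⟨_, splitGraph φ.toEquiv e, splitGraph_free h2 _ e.injective,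
    fun i => {v | v.2.1 = i}, ?_, ?_, ?_, ?_, ?_⟩
  · exact fun i => ⟨(false, i, 0, 0), rfl⟩
  · intro i j hij
    rw [Set.disjoint_left]
    rintro v rfl h
    exact hij h
  · ext v
    simp
  · intro i
    have hsub : {v : Bool × Fin r × K × F | v.2.1 = i} =
        Set.range fun x : Bool × K × F => (x.1, i, x.2) := by
      ext ⟨s, j, x⟩
      simp only [Set.mem_ofPred_eq, Set.mem_range, Prod.exists, Prod.mk.injEq]
      constructor
      · rintro rfl
        exact ⟨s, x.1, x.2, rfl, rfl, rfl⟩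
      · rintro ⟨a, b, c, rfl, rfl, rfl⟩
        rfl
    beta_reduce
    rw [hsub, ← Set.image_univ]
    refine (Set.encard_image_le _ _).trans ?_
    rw [Set.encard_univ, ENat.card_eq_coe_natCard, Nat.card_prod, Nat.card_prod, cK]
    norm_cast
    rw [Nat.card_eq_fintype_card, Fintype.card_bool]
    exact le_of_eq (by ring)
  · intro i j _
    obtain ⟨x, g, y, h, hadj⟩ := exists_splitGraph_adj φ e i j
    exact ⟨_, rfl, _, rfl, hadj⟩

theorem exists_theta_free_isRKGraph_of_prime {p r : ℕ} (hp : p.Prime) (h2 : p ≠ 2)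
    (hr : r ≤ p ^ 5) :
    ∃ (V : Type) (G : SimpleGraph V), (thetaGraph 3 4).Free G ∧ IsRKGraph G r (2 * p ^ 3) := by
  have : Fact p.Prime := ⟨hp⟩
  have hfin : Module.finrank (ZMod p) (GaloisField p 2) = 2 := GaloisField.finrank p two_ne_zero
  let φ : GaloisField p 2 ≃+ ZMod p × ZMod p :=
    (((Module.finBasisOfFinrankEq (ZMod p) (GaloisField p 2) hfin).equivFun).trans
      (LinearEquiv.finTwoArrow (ZMod p) (ZMod p))).toAddEquiv
  have := exists_theta_free_isRKGraph (F := ZMod p) (r := r)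
    (Ring.two_ne_zero (by rwa [ringChar.eq (GaloisField p 2) p])) φ (by simpa using hr)
  simpa using this

theorem exists_theta_free_isRKGraph_of_pos {r : ℕ} (hr : 1 ≤ r) :
    ∃ k : ℕ, (∃ (V : Type) (G : SimpleGraph V), (thetaGraph 3 4).Free G ∧ IsRKGraph G r k) ∧
      (k : ℝ) < 433 * (r : ℝ) ^ (3 / 5 : ℝ) := by
  have hr1 : (1 : ℝ) ≤ r := by exact_mod_cast hr
  obtain ⟨y, hy⟩ : ∃ y : ℝ, y = (r : ℝ) ^ (1 / 5 : ℝ) := ⟨_, rfl⟩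
  have hy1 : 1 ≤ y := hy ▸ Real.one_le_rpow hr1 (by norm_num)
  have hy5 : y ^ 5 = r := by
    rw [hy, ← Real.rpow_natCast, ← Real.rpow_mul (by positivity)]
    norm_num
  have hy3 : y ^ 3 = (r : ℝ) ^ (3 / 5 : ℝ) := by
    rw [hy, ← Real.rpow_natCast, ← Real.rpow_mul (by positivity)]
    norm_num
  -- Applying Bertrand's postulate to ⌈y⌉ + 1 ≥ 2 rather than ⌈y⌉ excludes p = 2.
  obtain ⟨p, hp, hp1, hp2⟩ := Nat.exists_prime_lt_and_le_two_mul (⌈y⌉₊ + 1) (by omega)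
  have hc : 1 ≤ ⌈y⌉₊ := Nat.one_le_ceil_iff.2 (by linarith)
  have hyp : y ≤ p := (Nat.le_ceil y).trans (by exact_mod_cast (by omega))
  refine ⟨2 * p ^ 3, exists_theta_free_isRKGraph_of_prime hp (by omega) ?_, ?_⟩
  · have : (r : ℝ) ≤ (p : ℝ) ^ 5 := hy5 ▸ pow_le_pow_left₀ (by linarith) hyp 5
    exact_mod_cast this
  -- p ≤ 2(y + 2) ≤ 6y as y ≥ 1, and 2 · 6³ = 432 < 433.
  · have h6 : (p : ℝ) ≤ 6 * y := by
      have h1 : (p : ℝ) ≤ 2 * (⌈y⌉₊ + 1) := by exact_mod_cast hp2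
      have h3 := Nat.ceil_lt_add_one (by linarith : 0 ≤ y)
      linarith
    rw [← hy3]
    push_cast
    have := pow_le_pow_left₀ (by positivity) h6 3
    have h0 : 1 ≤ y ^ 3 := one_le_pow₀ hy1
    nlinarith

/-! ### Sparse pairs of vertex sets in θ_{3,4}-free graphs -/

section ThetaFree

open Finset
open scoped Classical

/-- The number of pairs `(x, y) ∈ X × Y` of adjacent vertices. -/
noncomputable def adjCount {V : Type*} (G : SimpleGraph V) (X Y : Finset V) : ℕ :=
  ∑ y ∈ Y, #{x ∈ X | G.Adj x y}

theorem adjCount_comm {V : Type*} (G : SimpleGraph V) (X Y : Finset V) :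
    adjCount G X Y = adjCount G Y X := by
  simp only [adjCount, card_filter]
  rw [sum_comm]
  simp only [G.adj_comm]

theorem adjCount_erase_right {V : Type*} (G : SimpleGraph V) (X : Finset V) {Y : Finset V} {y : V}
    (hy : y ∈ Y) : adjCount G X (Y.erase y) + #{x ∈ X | G.Adj x y} = adjCount G X Y :=
  sum_erase_add _ _ hy

theorem adjCount_erase_left {V : Type*} (G : SimpleGraph V) {X : Finset V} (Y : Finset V) {x : V}
    (hx : x ∈ X) : adjCount G (X.erase x) Y + #{y ∈ Y | G.Adj x y} = adjCount G X Y := by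
  rw [adjCount_comm, adjCount_comm G X Y, ← adjCount_erase_right G Y hx]
  simp only [G.adj_comm]

/-- A pair of vertex sets spanning many edges contains a pair of large minimum degree. -/
theorem exists_subpair_of_lt_adjCount {V : Type*} (G : SimpleGraph V) (m : ℕ) :
    ∀ (n : ℕ) (X Y : Finset V), #X + #Y = n → m * (#X + #Y) < adjCount G X Y →
    ∃ X' ⊆ X, ∃ Y' ⊆ Y, Y'.Nonempty ∧ (∀ x ∈ X', m < #{y ∈ Y' | G.Adj x y}) ∧
      ∀ y ∈ Y', m < #{x ∈ X' | G.Adj x y} := by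
  intro n
  induction n with
  | zero =>
    intro X Y hn h
    have : Y = ∅ := card_eq_zero.1 (by omega)
    simp [adjCount, this] at h
  | succ n ih =>
    intro X Y hn h
    by_cases hX : ∃ x ∈ X, #{y ∈ Y | G.Adj x y} ≤ m
    · obtain ⟨x, hx, hxm⟩ := hX
      have h1 := adjCount_erase_left G Y hx
      have h2 := card_erase_add_one hx
      obtain ⟨X', hX', Y', hY', h'⟩ := ih (X.erase x) Y (by omega) (by
        rw [← h1, ← h2] at h
        nlinarith)
      exact ⟨X', hX'.trans (erase_subset _ _), Y', hY', h'⟩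
    · by_cases hY : ∃ y ∈ Y, #{x ∈ X | G.Adj x y} ≤ m
      · obtain ⟨y, hy, hym⟩ := hY
        have h1 := adjCount_erase_right G X hy
        have h2 := card_erase_add_one hy
        obtain ⟨X', hX', Y', hY', h'⟩ := ih X (Y.erase y) (by omega) (by
          rw [← h1, ← h2] at h
          nlinarith)
        exact ⟨X', hX', Y', hY'.trans (erase_subset _ _), h'⟩
      · push Not at hX hY
        refine ⟨X, Subset.rfl, Y, Subset.rfl, ?_, hX, hY⟩
        rw [nonempty_iff_ne_empty]
        rintro rfl
        simp [adjCount] at h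

/-- Three large sets have distinct representatives with distinct colours, avoiding a small set of
colours. -/
theorem exists_three_representatives {α β : Type*} (χ : α → β) (S : Fin 3 → Finset α) (F : Finset β)
    (h : ∀ i, #F + 3 ≤ #((S i).image χ)) :
    ∃ f : Fin 3 → α, Function.Injective (χ ∘ f) ∧ (∀ i, f i ∈ S i) ∧ ∀ i, χ (f i) ∉ F := by
  have pick : ∀ (i : Fin 3) (F' : Finset β), #F' ≤ #F + 2 → ∃ x ∈ S i, χ x ∉ F' := by
    intro i F' hF'
    obtain ⟨c, hc, hc'⟩ := exists_mem_notMem_of_card_lt_card (s := F') (t := (S i).image χ)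
      (by have := h i; omega)
    obtain ⟨x, hx, rfl⟩ := mem_image.1 hc
    exact ⟨x, hx, hc'⟩
  obtain ⟨x, hx, hx'⟩ := pick 0 F (by omega)
  have c1 := card_insert_le (χ x) F
  obtain ⟨y, hy, hy'⟩ := pick 1 (insert (χ x) F) (by omega)
  have c2 := card_insert_le (χ y) (insert (χ x) F)
  obtain ⟨z, hz, hz'⟩ := pick 2 (insert (χ y) (insert (χ x) F)) (by omega)
  simp only [mem_insert, not_or] at hy' hz'
  refine ⟨![x, y, z], ?_, ?_, ?_⟩
  · intro i j e
    fin_cases i <;> fin_cases j <;> simp at e ⊢ <;> grind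
  · intro i
    fin_cases i <;> assumption
  · intro i
    fin_cases i
    exacts [hx', hy'.2, hz'.2.2]

theorem exists_three_distinct {α : Type*} (S : Fin 3 → Finset α) (F : Finset α)
    (h : ∀ i, #F + 3 ≤ #(S i)) :
    ∃ f : Fin 3 → α, Function.Injective f ∧ (∀ i, f i ∈ S i) ∧ ∀ i, f i ∉ F :=
  exists_three_representatives id S F (by simpa using h)

/-- If each `y ∈ Y` has neighbours of at most `t` colours in `X`, then it suffices to bound the
number of edges between each colour class of `X` and subsets of `Y`. -/
theorem adjCount_le_of_colours {V W : Type*} (G : SimpleGraph V) (X Y : Finset V) (χ : V → W)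
    (t B : ℕ) (ht : ∀ y ∈ Y, #(({x ∈ X | G.Adj x y}).image χ) ≤ t)
    (hB : ∀ p ∈ X.image χ, ∀ Y' ⊆ Y,
      adjCount G {x ∈ X | χ x = p} Y' ≤ B * (#{x ∈ X | χ x = p} + #Y')) :
    adjCount G X Y ≤ t * B * (#X + #Y) := by
  -- Keeping only the most frequent colour at each y loses a factor of at most t, and then each y
  -- meets a single colour class.
  have hpop : ∀ y, ∃ p, y ∈ Y →
      #{x ∈ X | G.Adj x y} ≤ t * #{x ∈ {x ∈ X | χ x = p} | G.Adj x y} := by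
    intro y
    obtain hN | hN := ({x ∈ X | G.Adj x y}).eq_empty_or_nonempty
    · exact ⟨χ y, fun _ => by simp [hN]⟩
    obtain ⟨p, hp, hmax⟩ := exists_max_image (({x ∈ X | G.Adj x y}).image χ)
      (fun p => #{x ∈ ({x ∈ X | G.Adj x y}) | χ x = p}) (hN.image χ)
    refine ⟨p, fun hy => ?_⟩
    have h1 := card_le_mul_card_image (f := χ) ({x ∈ X | G.Adj x y}) _ hmax
    have h3 := ht y hy
    rw [filter_comm]
    nlinarith
  choose π hπ using hpop
  have hclass : ∀ p, adjCount G {x ∈ X | χ x = p} {y ∈ Y | π y = p} ≤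
      B * (#{x ∈ X | χ x = p} + #{y ∈ Y | π y = p}) := by
    intro p
    by_cases hp : p ∈ X.image χ
    · exact hB p hp _ (filter_subset _ _)
    · have h0 : {x ∈ X | χ x = p} = ∅ :=
        filter_eq_empty_iff.2 fun x hx e => hp (mem_image.2 ⟨x, hx, e⟩)
      simp [h0, adjCount]
  have hX : ∀ x ∈ X, χ x ∈ X.image χ ∪ Y.image π := fun x hx =>
    mem_union_left _ (mem_image_of_mem _ hx)
  have hY : ∀ y ∈ Y, π y ∈ X.image χ ∪ Y.image π := fun y hy =>
    mem_union_right _ (mem_image_of_mem _ hy)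
  calc adjCount G X Y
      ≤ ∑ y ∈ Y, t * #{x ∈ {x ∈ X | χ x = π y} | G.Adj x y} := sum_le_sum fun y hy => hπ y hy
    _ = t * ∑ p ∈ X.image χ ∪ Y.image π, adjCount G {x ∈ X | χ x = p} {y ∈ Y | π y = p} := by
        rw [← mul_sum, ← sum_fiberwise_of_maps_to hY]
        refine congrArg _ (sum_congr rfl fun p _ => sum_congr rfl fun y hy => ?_)
        rw [(mem_filter.1 hy).2]
    _ ≤ t * ∑ p ∈ X.image χ ∪ Y.image π,
          B * (#{x ∈ X | χ x = p} + #{y ∈ Y | π y = p}) :=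
        Nat.mul_le_mul_left _ (sum_le_sum fun p _ => hclass p)
    _ = t * B * (#X + #Y) := by
        rw [← mul_sum, sum_add_distrib, ← card_eq_sum_card_fiberwise hX,
          ← card_eq_sum_card_fiberwise hY, mul_assoc]

/-- In a subpair of large minimum degree, three disjoint paths of length three can be grown greedily
from any y₀ back to neighbours of v. X and Y may overlap, so all earlier choices are avoided
explicitly: the last step forbids 7 vertices and picks 3, whence the 10. -/
theorem adjCount_le_of_star {V : Type*} {G : SimpleGraph V} (hG : (thetaGraph 3 4).Free G) {v : V}
    {X Y : Finset V} (hX : ∀ x ∈ X, G.Adj v x) (hv : v ∉ Y) :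
    adjCount G X Y ≤ 10 * (#X + #Y) := by
  by_contra! hcon
  obtain ⟨X', hX', Y', hY', ⟨y₀, hy₀⟩, hdX, hdY⟩ := exists_subpair_of_lt_adjCount G 10 _ X Y rfl hcon
  obtain ⟨c, hc, hcm, -⟩ := exists_three_distinct (fun _ => {x ∈ X' | G.Adj x y₀}) ∅
    (fun _ => by have := hdY y₀ hy₀; simp only [card_empty]; omega)
  simp only [mem_filter] at hcm
  have cc : #(univ.image c) ≤ 3 := card_image_le
  obtain ⟨b, hb, hbm, hbF⟩ := exists_three_distinct (fun i => {y ∈ Y' | G.Adj (c i) y})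
    (insert y₀ (univ.image c)) (fun i => by
      have := hdX _ (hcm i).1
      have := card_insert_le y₀ (univ.image c)
      omega)
  simp only [mem_filter, mem_insert, mem_image, mem_univ, true_and, not_or, not_exists] at hbm hbF
  have cb : #(univ.image b) ≤ 3 := card_image_le
  obtain ⟨a, ha, ham, haF⟩ := exists_three_distinct (fun i => {x ∈ X' | G.Adj x (b i)})
    (insert y₀ (univ.image c ∪ univ.image b)) (fun i => by
      have := hdY _ (hbm i).1
      have := card_insert_le y₀ (univ.image c ∪ univ.image b)
      have := card_union_le (univ.image c) (univ.image b)
      omega)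
  simp only [mem_filter, mem_insert, mem_image, mem_union, mem_univ, true_and, not_or,
    not_exists] at ham haF
  refine hG (IsTheta.isContained (s := v) (t := y₀) (a := a) (b := b) (c := c) ?_)
  have hvY : ∀ y ∈ Y', y ≠ v := fun y hy e => hv (e ▸ hY' hy)
  exact
    { sa := fun i => hX _ (hX' (ham i).1)
      ab := fun i => (ham i).2
      bc := fun i => (hbm i).2.symm
      ct := fun i => (hcm i).2
      a_inj := ha
      b_inj := hb
      c_inj := hc
      s_ne_t := (hvY _ hy₀).symm
      a_ne_t := fun i => (haF i).1
      b_ne_s := fun i => hvY _ (hbm i).1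
      b_ne_t := fun i => (hbF i).1
      c_ne_s := fun i => (hX _ (hX' (hcm i).1)).ne'
      a_ne_b := fun i j e => (haF i).2.2 j e.symm
      a_ne_c := fun i j e => (haF i).2.1 j e.symm
      b_ne_c := fun i j e => (hbF i).2 j e.symm }

/-- `ℓ` plays the role of the distance to a root, and `par` of the parent in a search tree. -/
theorem adjCount_le_of_depth_two {V : Type*} {G : SimpleGraph V} (hG : (thetaGraph 3 4).Free G)
    (ℓ : V → ℕ) (par : V → V) {v : V} {X Y : Finset V}
    (hX : ∀ x ∈ X, ℓ x = ℓ v + 2 ∧ ℓ (par x) = ℓ v + 1 ∧ G.Adj (par x) x ∧ G.Adj v (par x))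
    (hY : ∀ y ∈ Y, ℓ v + 2 ≤ ℓ y) : adjCount G X Y ≤ 62 * (#X + #Y) := by
  -- Rich vertices see at least 7 parents. Three rich neighbours of one x₀ would give a theta from v
  -- to x₀: forbid the parents of x₀ and of the three neighbours, then choose 3 new ones, 4 + 3 = 7.
  obtain ⟨R, hR⟩ : ∃ R, R = {y ∈ Y | 7 ≤ #(({x ∈ X | G.Adj x y}).image par)} := ⟨_, rfl⟩
  obtain ⟨P, hP⟩ : ∃ P, P = {y ∈ Y | ¬ 7 ≤ #(({x ∈ X | G.Adj x y}).image par)} := ⟨_, rfl⟩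
  have hsplit : adjCount G X Y = adjCount G X R + adjCount G X P := by
    rw [hR, hP]
    exact (sum_filter_add_sum_filter_not _ _ _).symm
  have hPY : #P ≤ #Y := hP ▸ card_filter_le _ _
  have hrich : adjCount G X R ≤ 2 * #X := by
    rw [adjCount_comm, adjCount, mul_comm, ← smul_eq_mul]
    refine sum_le_card_nsmul _ _ _ fun x₀ hx₀ => ?_
    by_contra! hcon
    obtain ⟨c, hc, hcm, -⟩ := exists_three_distinct (fun _ => {y ∈ R | G.Adj y x₀}) ∅
      (fun _ => by simp only [card_empty]; omega)
    simp only [mem_filter, hR] at hcm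
    have cc : #((insert x₀ (univ.image c)).image par) ≤ 4 := by
      have h1 : #(univ.image c) ≤ 3 := card_image_le
      have h2 := card_insert_le x₀ (univ.image c)
      exact card_image_le.trans (by omega)
    obtain ⟨b, hb, hbm, hbF⟩ := exists_three_representatives par (fun i => {x ∈ X | G.Adj x (c i)})
      ((insert x₀ (univ.image c)).image par) (fun i => by have := (hcm i).1.2; omega)
    simp only [mem_filter] at hbm
    have hbF' : ∀ i, ∀ z ∈ insert x₀ (univ.image c), b i ≠ z := fun i z hz e =>
      hbF i (e ▸ mem_image_of_mem _ hz)
    have hℓb := fun i => hX _ (hbm i).1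
    have hℓc := fun i => hY _ (hcm i).1.1
    have hℓx := (hX _ hx₀).1
    refine hG (IsTheta.isContained (s := v) (t := x₀) (a := par ∘ b) (b := b) (c := c) ?_)
    exact
      { sa := fun i => (hℓb i).2.2.2
        ab := fun i => (hℓb i).2.2.1
        bc := fun i => (hbm i).2
        ct := fun i => (hcm i).2
        a_inj := hb
        b_inj := hb.of_comp
        c_inj := hc
        s_ne_t := fun e => by rw [e] at hℓx; omega
        a_ne_t := fun i e => by
          have := (hℓb i).2.1
          simp only [Function.comp_apply] at e
          rw [e] at this
          omega
        b_ne_s := fun i e => by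
          have := (hℓb i).1
          rw [e] at this
          omega
        b_ne_t := fun i => hbF' i _ (mem_insert_self _ _)
        c_ne_s := fun i e => by
          have := hℓc i
          rw [e] at this
          omega
        a_ne_b := fun i j e => by
          have := (hℓb i).2.1
          have := (hℓb j).1
          simp only [Function.comp_apply] at e
          rw [← e] at this
          omega
        a_ne_c := fun i j e => by
          have := (hℓb i).2.1
          have := hℓc j
          simp only [Function.comp_apply] at e
          rw [← e] at this
          omega
        b_ne_c := fun i j => hbF' i _ (mem_insert_of_mem (mem_image_of_mem _ (mem_univ _))) }
  -- Poor vertices see at most 6 parents, and each class of siblings is a star at its parent. In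
  -- total 2 + 6 · 10 = 62.
  have hpoor : adjCount G X P ≤ 6 * 10 * (#X + #P) := by
    refine adjCount_le_of_colours G X P par 6 10 ?_ ?_
    · intro y hy
      rw [hP, mem_filter] at hy
      omega
    · intro p hp Y' hY'
      obtain ⟨x, hx, rfl⟩ := mem_image.1 hp
      refine adjCount_le_of_star hG (v := par x) ?_ ?_
      · intro z hz
        rw [mem_filter] at hz
        rw [← hz.2]
        exact (hX z hz.1).2.2.1
      · intro h
        have h' := hY' h
        rw [hP, mem_filter] at h'
        have := hY _ h'.1
        have := (hX x hx).2.1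
        omega
  omega

/-- A vertex of Y seeing three grandparents would close three tree paths from v into a theta. So at
most 2 occur, and each class lies at depth two below its grandparent: 2 · 62 = 124. -/
theorem adjCount_le_of_depth_three {V : Type*} {G : SimpleGraph V} (hG : (thetaGraph 3 4).Free G)
    (ℓ : V → ℕ) (par : V → V) {v : V} {X Y : Finset V}
    (hX : ∀ x ∈ X, ℓ x = ℓ v + 3 ∧ ℓ (par x) = ℓ v + 2 ∧ ℓ (par (par x)) = ℓ v + 1 ∧
      G.Adj (par x) x ∧ G.Adj (par (par x)) (par x) ∧ G.Adj v (par (par x)))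
    (hY : ∀ y ∈ Y, ℓ v + 3 ≤ ℓ y) : adjCount G X Y ≤ 124 * (#X + #Y) := by
  refine adjCount_le_of_colours G X Y (par ∘ par) 2 62 ?_ ?_
  · intro y hy
    by_contra! hcon
    obtain ⟨c, hc, hcm, -⟩ := exists_three_representatives (par ∘ par)
      (fun _ => {x ∈ X | G.Adj x y}) ∅ (fun i => by simp only [card_empty]; omega)
    simp only [mem_filter] at hcm
    have hℓc := fun i => hX _ (hcm i).1
    have hℓy := hY y hy
    have hne : ∀ {p q : V}, ℓ p ≠ ℓ q → p ≠ q := fun h e => h (congrArg ℓ e)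
    refine hG (IsTheta.isContained (s := v) (t := y) (a := (par ∘ par) ∘ c) (b := par ∘ c)
      (c := c) ?_)
    exact
      { sa := fun i => (hℓc i).2.2.2.2.2
        ab := fun i => (hℓc i).2.2.2.2.1
        bc := fun i => (hℓc i).2.2.2.1
        ct := fun i => (hcm i).2
        a_inj := hc
        b_inj := Function.Injective.of_comp (f := par) hc
        c_inj := hc.of_comp
        s_ne_t := hne (by omega)
        a_ne_t := fun i => hne (by have := hℓc i; simp only [Function.comp_apply]; omega)
        b_ne_s := fun i => hne (by have := hℓc i; simp only [Function.comp_apply]; omega)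
        b_ne_t := fun i => hne (by have := hℓc i; simp only [Function.comp_apply]; omega)
        c_ne_s := fun i => hne (by have := hℓc i; omega)
        a_ne_b := fun i j => hne (by
          have := hℓc i; have := hℓc j; simp only [Function.comp_apply]; omega)
        a_ne_c := fun i j => hne (by
          have := hℓc i; have := hℓc j; simp only [Function.comp_apply]; omega)
        b_ne_c := fun i j => hne (by
          have := hℓc i; have := hℓc j; simp only [Function.comp_apply]; omega) }
  · intro p hp Y' hY'
    obtain ⟨x, hx, rfl⟩ := mem_image.1 hp
    have hp1 := (hX x hx).2.2.1
    refine adjCount_le_of_depth_two hG ℓ par (v := par (par x)) ?_ ?_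
    · intro z hz
      simp only [mem_filter, Function.comp_apply] at hz
      have h := hX z hz.1
      refine ⟨by omega, by omega, h.2.2.2.1, ?_⟩
      rw [← hz.2]
      exact h.2.2.2.2.1
    · intro y hy
      have := hY y (hY' hy)
      omega

end ThetaFree

/-! ### Growth of distance levels and the Faudree–Simonovits bound -/

section Density

open Finset
open scoped Classical

theorem exists_adj_dist_eq_of_dist_eq_succ {V : Type*} {G : SimpleGraph V} {v u : V} {i : ℕ}
    (h : G.dist v u = i + 1) : ∃ w, G.Adj w u ∧ G.dist v w = i := by
  obtain ⟨p, hp⟩ := SimpleGraph.exists_walk_of_dist_ne_zero (G := G) (u := v) (v := u) (by omega)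
  have hnil : ¬ p.Nil := by
    rw [← SimpleGraph.Walk.length_eq_zero_iff]
    omega
  have hadj := p.adj_penultimate hnil
  refine ⟨_, hadj, ?_⟩
  have h1 := SimpleGraph.dist_le p.dropLast
  rw [SimpleGraph.Walk.length_dropLast] at h1
  have h2 := hadj.diff_dist_adj (u := v)
  omega

/-- The vertices at distance `i` from `v`. -/
noncomputable def distLevel {V : Type*} [Fintype V] (G : SimpleGraph V) (v : V) (i : ℕ) :
    Finset V :=
  {u | G.Reachable v u ∧ G.dist v u = i}

theorem mem_distLevel {V : Type*} [Fintype V] {G : SimpleGraph V} {v u : V} {i : ℕ} :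
    u ∈ distLevel G v i ↔ G.Reachable v u ∧ G.dist v u = i := by
  simp [distLevel]

theorem distLevel_zero {V : Type*} [Fintype V] (G : SimpleGraph V) (v : V) :
    distLevel G v 0 = {v} := by
  ext u
  rw [mem_distLevel, mem_singleton]
  constructor
  · rintro ⟨h, h0⟩
    exact (h.dist_eq_zero_iff.1 h0).symm
  · rintro rfl
    exact ⟨.rfl, SimpleGraph.dist_self⟩

/-- In a `θ_{3,4}`-free graph, few edges run between or within the first distance levels. -/
theorem adjCount_distLevel_le {V : Type*} [Fintype V] {G : SimpleGraph V}
    (hG : (thetaGraph 3 4).Free G) (v : V) {i j : ℕ} (hi : i ≤ 3) (hij : i ≤ j) :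
    adjCount G (distLevel G v i) (distLevel G v j) ≤
      124 * (#(distLevel G v i) + #(distLevel G v j)) := by
  have hpar : ∀ u, ∃ w, ∀ k, G.dist v u = k + 1 → G.Adj w u ∧ G.dist v w = k := by
    intro u
    rcases h : G.dist v u with _ | k
    · exact ⟨u, fun k hk => by omega⟩
    · obtain ⟨w, hw⟩ := exists_adj_dist_eq_of_dist_eq_succ h
      refine ⟨w, fun k' hk' => ?_⟩
      obtain rfl : k = k' := by omega
      exact hw
  choose par hpar using hpar
  have hv : G.dist v v = 0 := SimpleGraph.dist_self
  have hY : ∀ y ∈ distLevel G v j, i ≤ G.dist v y := fun y hy => by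
    rw [(mem_distLevel.1 hy).2]
    exact hij
  have hX : ∀ x ∈ distLevel G v i, G.dist v x = i := fun x hx => (mem_distLevel.1 hx).2
  interval_cases i
  · refine (sum_le_card_nsmul _ _ 1 fun y _ => ?_).trans ?_
    · refine (card_filter_le _ _).trans ?_
      rw [distLevel_zero, card_singleton]
    · rw [smul_eq_mul]
      omega
  · refine (adjCount_le_of_star hG (v := v) (fun x hx => ?_) ?_).trans (by omega)
    · exact SimpleGraph.dist_eq_one_iff_adj.1 (hX x hx)
    · intro h
      have := hY v h
      omega
  · refine (adjCount_le_of_depth_two hG (G.dist v) par (v := v) (fun x hx => ?_) ?_).trans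
      (by omega)
    · have h2 := hX x hx
      obtain ⟨h3, h4⟩ := hpar x 1 h2
      exact ⟨by omega, by omega, h3, SimpleGraph.dist_eq_one_iff_adj.1 h4⟩
    · simpa [hv] using hY
  · refine adjCount_le_of_depth_three hG (G.dist v) par (v := v) (fun x hx => ?_) ?_
    · have h2 := hX x hx
      obtain ⟨h3, h4⟩ := hpar x 2 h2
      obtain ⟨h5, h6⟩ := hpar (par x) 1 h4
      exact ⟨by omega, by omega, by omega, h3, h5, SimpleGraph.dist_eq_one_iff_adj.1 h6⟩
    · simpa [hv] using hY

/-- The distance levels of a `θ_{3,4}`-free graph of large minimum degree grow quickly. -/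
theorem mul_card_distLevel_le {V : Type*} [Fintype V] {G : SimpleGraph V}
    (hG : (thetaGraph 3 4).Free G) {δ : ℕ} (hδ : 1240 ≤ δ)
    (hdeg : ∀ u, δ ≤ #{w | G.Adj w u}) (v : V) {i : ℕ} (hi : i + 1 ≤ 3)
    (hle : #(distLevel G v i) ≤ #(distLevel G v (i + 1))) :
    δ * #(distLevel G v (i + 1)) ≤ 248 * #(distLevel G v (i + 2)) := by
  have h0 := adjCount_distLevel_le hG v (i := i) (j := i + 1) (by omega) (by omega)
  have h1 := adjCount_distLevel_le hG v (i := i + 1) (j := i + 1) (by omega) (by omega)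
  have h2 := adjCount_distLevel_le hG v (i := i + 1) (j := i + 2) (by omega) (by omega)
  rw [adjCount_comm] at h2
  have hsum : δ * #(distLevel G v (i + 1)) ≤
      adjCount G (distLevel G v i) (distLevel G v (i + 1)) +
      adjCount G (distLevel G v (i + 1)) (distLevel G v (i + 1)) +
      adjCount G (distLevel G v (i + 2)) (distLevel G v (i + 1)) := by
    rw [adjCount, adjCount, adjCount, ← sum_add_distrib, ← sum_add_distrib, mul_comm,
      ← smul_eq_mul]
    refine card_nsmul_le_sum _ _ _ fun u hu => (hdeg u).trans ?_
    have hsub : ({w | G.Adj w u} : Finset V) ⊆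
        ({w ∈ distLevel G v i | G.Adj w u} ∪ {w ∈ distLevel G v (i + 1) | G.Adj w u}) ∪
          {w ∈ distLevel G v (i + 2) | G.Adj w u} := by
      intro w hw
      rw [mem_filter] at hw
      rw [mem_distLevel] at hu
      have hr : G.Reachable v w := hu.1.trans hw.2.symm.reachable
      have hd := hw.2.symm.diff_dist_adj (u := v)
      simp only [mem_union, mem_filter, mem_distLevel, hw.2, hr, true_and, and_true]
      omega
    refine (card_le_card hsub).trans ((card_union_le _ _).trans ?_)
    exact Nat.add_le_add_right (card_union_le _ _) _
  -- The three bounds add up to 620|L_{i+1}| + 124|L_{i+2}|; since δ ≥ 1240, the first term is at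
  -- most half of the left side, and doubling gives 248.
  nlinarith

theorem pow_four_le_card_of_minDegree {V : Type*} [Fintype V] [Nonempty V] {G : SimpleGraph V}
    (hG : (thetaGraph 3 4).Free G) {δ : ℕ} (hδ : 1240 ≤ δ)
    (hdeg : ∀ u, δ ≤ #{w | G.Adj w u}) : δ ^ 4 ≤ 248 ^ 3 * Fintype.card V := by
  obtain ⟨v⟩ := ‹Nonempty V›
  have c0 : #(distLevel G v 0) = 1 := by rw [distLevel_zero, card_singleton]
  have c1 : δ ≤ #(distLevel G v 1) := by
    refine (hdeg v).trans (card_le_card fun w hw => ?_)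
    rw [mem_filter] at hw
    exact mem_distLevel.2 ⟨hw.2.symm.reachable, SimpleGraph.dist_eq_one_iff_adj.2 hw.2.symm⟩
  have s1 := mul_card_distLevel_le hG hδ hdeg v (i := 0) (by omega)
    (by rw [c0]; exact le_trans (by omega) c1)
  have s2 := mul_card_distLevel_le hG hδ hdeg v (i := 1) (by omega) (by
    simp only [Nat.zero_add] at s1; nlinarith)
  have s3 := mul_card_distLevel_le hG hδ hdeg v (i := 2) (by omega) (by
    simp only [Nat.reduceAdd] at s2; nlinarith)
  have c4 : #(distLevel G v 4) ≤ Fintype.card V := card_le_univ _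
  simp only [Nat.reduceAdd] at s1 s2 s3
  calc δ ^ 4 = δ ^ 3 * δ := by ring
    _ ≤ δ ^ 3 * #(distLevel G v 1) := Nat.mul_le_mul_left _ c1
    _ = δ ^ 2 * (δ * #(distLevel G v 1)) := by ring
    _ ≤ δ ^ 2 * (248 * #(distLevel G v 2)) := Nat.mul_le_mul_left _ s1
    _ = 248 * δ * (δ * #(distLevel G v 2)) := by ring
    _ ≤ 248 * δ * (248 * #(distLevel G v 3)) := Nat.mul_le_mul_left _ s2
    _ = 248 ^ 2 * (δ * #(distLevel G v 3)) := by ring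
    _ ≤ 248 ^ 2 * (248 * #(distLevel G v 4)) := Nat.mul_le_mul_left _ s3
    _ = 248 ^ 3 * #(distLevel G v 4) := by ring
    _ ≤ 248 ^ 3 * Fintype.card V := Nat.mul_le_mul_left _ c4

/-- A vertex set of average degree at least `2δ` contains one of minimum degree at least `δ`. -/
theorem exists_subset_minDegree {V : Type*} (G : SimpleGraph V) (δ : ℕ) :
    ∀ (n : ℕ) (S : Finset V), #S = n → S.Nonempty → 2 * δ * #S ≤ adjCount G S S →
    ∃ T ⊆ S, T.Nonempty ∧ ∀ u ∈ T, δ ≤ #{w ∈ T | G.Adj w u} := by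
  intro n
  induction n with
  | zero =>
    intro S hn hS
    exact absurd hn hS.card_pos.ne'
  | succ n ih =>
    intro S hn hS h
    by_cases hu : ∀ u ∈ S, δ ≤ #{w ∈ S | G.Adj w u}
    · exact ⟨S, Subset.rfl, hS, hu⟩
    push Not at hu
    obtain ⟨u, hu, hlt⟩ := hu
    have h1 := adjCount_erase_left G S hu
    have h2 := adjCount_erase_right G (S.erase u) hu
    have h3 : #{x ∈ S.erase u | G.Adj x u} ≤ #{w ∈ S | G.Adj w u} :=
      card_le_card (filter_subset_filter _ (erase_subset _ _))
    have h4 : #{y ∈ S | G.Adj u y} = #{w ∈ S | G.Adj w u} := by simp only [G.adj_comm]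
    have h5 := card_erase_add_one hu
    have h6 : 2 * δ * #(S.erase u) < adjCount G (S.erase u) (S.erase u) := by
      rw [← h5] at h
      nlinarith
    have hne : (S.erase u).Nonempty := by
      rw [nonempty_iff_ne_empty]
      intro h0
      simp [h0, adjCount] at h6
    obtain ⟨T, hT, hT'⟩ := ih (S.erase u) (by omega) hne h6.le
    exact ⟨T, hT.trans (erase_subset _ _), hT'⟩

/-- The Faudree–Simonovits bound for `θ_{3,4}`. -/
theorem pow_four_le_card_of_adjCount {V : Type*} [Fintype V] [Nonempty V] {G : SimpleGraph V}
    (hG : (thetaGraph 3 4).Free G) {δ : ℕ} (hδ : 1240 ≤ δ)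
    (h : 2 * δ * Fintype.card V ≤ adjCount G univ univ) : δ ^ 4 ≤ 248 ^ 3 * Fintype.card V := by
  obtain ⟨T, -, hT, hdeg⟩ := exists_subset_minDegree G δ _ univ rfl univ_nonempty h
  have : Nonempty T := hT.to_subtype
  have hfree : (thetaGraph 3 4).Free (G.induce (T : Set V)) := fun hc =>
    hG (hc.trans ⟨SimpleGraph.Copy.induce G _⟩)
  have key := pow_four_le_card_of_minDegree (V := T) hfree hδ fun u => by
    refine (hdeg u u.2).trans ?_
    rw [← card_image_of_injective _ Subtype.val_injective]
    refine card_le_card fun w hw => ?_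
    rw [mem_filter] at hw
    exact mem_image.2 ⟨⟨w, hw.1⟩, mem_filter.2 ⟨mem_univ _, hw.2⟩, rfl⟩
  refine key.trans (Nat.mul_le_mul_left _ ?_)
  rw [Fintype.card_coe]
  exact card_le_univ _

/-! ### Vertex and edge counts of (r, k)-graphs -/

theorem IsRKGraph.finite {V : Type*} {G : SimpleGraph V} {r k : ℕ} (h : IsRKGraph G r k) :
    Finite V := by
  obtain ⟨P, -, -, hU, hk, -⟩ := h
  rw [← Set.finite_univ_iff, ← hU]
  exact Set.finite_iUnion fun i => Set.finite_of_encard_le_coe (hk i)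

theorem IsRKGraph.card_le {V : Type*} [Fintype V] {G : SimpleGraph V} {r k : ℕ}
    (h : IsRKGraph G r k) : Fintype.card V ≤ r * k := by
  obtain ⟨P, -, -, hU, hk, -⟩ := h
  have h1 : (Fintype.card V : ℕ∞) ≤ ∑ i, (P i).encard := by
    rw [← Nat.card_eq_fintype_card, ← ENat.card_eq_coe_natCard, ← Set.encard_univ, ← hU]
    exact Set.encard_iUnion_le_of_fintype P
  have h2 := h1.trans (sum_le_card_nsmul univ _ (k : ℕ∞) fun i _ => hk i)
  rw [card_univ, Fintype.card_fin, nsmul_eq_mul] at h2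
  exact_mod_cast h2

/-- Choose one edge for each ordered pair of distinct parts; disjointness recovers the pair from the
edge. -/
theorem IsRKGraph.le_adjCount {V : Type*} [Fintype V] {G : SimpleGraph V} {r k : ℕ}
    (h : IsRKGraph G r k) : r * (r - 1) ≤ adjCount G univ univ := by
  obtain ⟨P, hP, hdisj, -, -, hadj⟩ := h
  have hexists : ∀ q : Fin r × Fin r, ∃ e : V × V, q.1 ≠ q.2 →
      e.1 ∈ P q.1 ∧ e.2 ∈ P q.2 ∧ G.Adj e.1 e.2 := by
    intro q
    by_cases hq : q.1 = q.2
    · exact ⟨((hP q.1).some, (hP q.1).some), fun h => absurd hq h⟩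
    · obtain ⟨x, hx, y, hy, hxy⟩ := hadj _ _ hq
      exact ⟨(x, y), fun _ => ⟨hx, hy, hxy⟩⟩
  choose f hf using hexists
  have hcount : adjCount G univ univ = #{e : V × V | G.Adj e.1 e.2} := by
    simp only [adjCount, card_filter]
    rw [sum_comm, ← univ_product_univ, sum_product]
  have hsame : ∀ {i j : Fin r} {x : V}, x ∈ P i → x ∈ P j → i = j := fun hi hj => by
    by_contra hne
    exact Set.disjoint_left.1 (hdisj _ _ hne) hi hj
  rw [hcount, Nat.mul_sub_one]
  have hoff := offDiag_card (univ : Finset (Fin r))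
  rw [card_univ, Fintype.card_fin] at hoff
  rw [← hoff]
  refine card_le_card_of_injOn f (fun q hq => ?_) fun q hq q' hq' e => ?_
  · have := hf q (mem_offDiag.1 hq).2.2
    simpa using this.2.2
  · have h1 := hf q (mem_offDiag.1 hq).2.2
    have h2 := hf q' (mem_offDiag.1 hq').2.2
    rw [← e] at h2
    exact Prod.ext (hsame h1.1 h2.1) (hsame h1.2.1 h2.2.1)

theorem IsRKGraph.pow_three_le {V : Type*} {G : SimpleGraph V} {r k : ℕ} (hr : 1 ≤ r)
    (h : IsRKGraph G r k) (hG : (thetaGraph 3 4).Free G) : r ^ 3 ≤ 2480 ^ 3 * k ^ 5 := by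
  have := h.finite
  have := Fintype.ofFinite V
  have hcard := h.card_le
  have hadj := h.le_adjCount
  have hne : Nonempty V := by
    obtain ⟨P, hP, -⟩ := h
    exact ⟨(hP ⟨0, hr⟩).some⟩
  have hk : 1 ≤ k := by
    rcases Nat.eq_zero_or_pos k with rfl | hk
    · have := Fintype.card_pos (α := V)
      omega
    · exact hk
  -- The largest δ for which r(r - 1) ordered adjacent pairs on rk vertices guarantee average degree
  -- 2δ.
  obtain ⟨δ, hδ⟩ : ∃ δ, δ = (r - 1) / (2 * k) := ⟨_, rfl⟩
  have hδ1 : 2 * k * δ ≤ r - 1 := hδ ▸ Nat.mul_div_le _ _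
  have hδ2 : r - 1 < 2 * k * (δ + 1) := hδ ▸ Nat.lt_mul_div_succ _ (by omega)
  have hrk : r ≤ 2 * k * (δ + 1) := by omega
  by_cases hbig : 1240 ≤ δ
  · have key := pow_four_le_card_of_adjCount hG hbig (by
      calc 2 * δ * Fintype.card V ≤ 2 * δ * (r * k) := Nat.mul_le_mul_left _ hcard
        _ = r * (2 * k * δ) := by ring
        _ ≤ r * (r - 1) := Nat.mul_le_mul_left _ hδ1
        _ ≤ _ := hadj)
    have hrδ : r ≤ 4 * k * δ := by
      calc r ≤ 2 * k * (δ + 1) := hrk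
        _ ≤ 2 * k * (2 * δ) := Nat.mul_le_mul_left _ (by omega)
        _ = 4 * k * δ := by ring
    have h4 : r * r ^ 3 ≤ r * (2480 ^ 3 * k ^ 5) := by
      calc r * r ^ 3 = r ^ 4 := by ring
        _ ≤ (4 * k * δ) ^ 4 := Nat.pow_le_pow_left hrδ 4
        _ = 256 * k ^ 4 * δ ^ 4 := by ring
        _ ≤ 256 * k ^ 4 * (248 ^ 3 * (r * k)) :=
          Nat.mul_le_mul_left _ (key.trans (Nat.mul_le_mul_left _ hcard))
        _ = 256 * 248 ^ 3 * (r * k ^ 5) := by ring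
        _ ≤ 2480 ^ 3 * (r * k ^ 5) := Nat.mul_le_mul_right _ (by norm_num)
        _ = r * (2480 ^ 3 * k ^ 5) := by ring
    exact Nat.le_of_mul_le_mul_left h4 hr
  -- For small δ, r is already linear in k; 2480 = 2 · 1240 also serves above, since 2480³ = 1000 ·
  -- 248³.
  · have hrδ : r ≤ 2480 * k := by
      calc r ≤ 2 * k * (δ + 1) := hrk
        _ ≤ 2 * k * 1240 := Nat.mul_le_mul_left _ (by omega)
        _ = 2480 * k := by ring
    calc r ^ 3 ≤ (2480 * k) ^ 3 := Nat.pow_le_pow_left hrδ 3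
      _ = 2480 ^ 3 * k ^ 3 := by ring
      _ ≤ 2480 ^ 3 * k ^ 5 := Nat.mul_le_mul_left _ (Nat.pow_le_pow_right hk (by norm_num))

end Density

/-! ### Assembling the two bounds -/

theorem theorem1p6 :
    ∃ c C : ℝ, 0 < c ∧ 0 < C ∧ ∀ r : ℕ, 1 ≤ r →
      c * (r : ℝ) ^ (3 / 5 : ℝ) < (minSplit r (thetaGraph 3 4) : ℝ) ∧
      (minSplit r (thetaGraph 3 4) : ℝ) < C * (r : ℝ) ^ (3 / 5 : ℝ) := by
  -- The extra factor 1/2 makes the lower inequality strict.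
  refine ⟨1 / 2480 ^ 3 / 2, 433, by norm_num, by norm_num, fun r hr => ?_⟩
  obtain ⟨k, hk, hlt⟩ := exists_theta_free_isRKGraph_of_pos hr
  constructor
  -- The construction also serves the lower bound: it rules out the default value 0 of an empty
  -- infimum, so the minimum is attained.
  · obtain ⟨V, G, hG, hrk⟩ := Nat.sInf_mem (s := {k : ℕ | ∃ (V : Type) (G : SimpleGraph V),
      (thetaGraph 3 4).Free G ∧ IsRKGraph G r k}) ⟨k, hk⟩
    change IsRKGraph G r (minSplit r (thetaGraph 3 4)) at hrk
    have h3 := hrk.pow_three_le hr hG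
    generalize minSplit r (thetaGraph 3 4) = m at *
    have h5 : (r : ℝ) ^ 3 ≤ 2480 ^ 3 * (m : ℝ) ^ 5 := by exact_mod_cast h3
    have hr1 : (1 : ℝ) ≤ r := by exact_mod_cast hr
    have hy5 : ((r : ℝ) ^ (3 / 5 : ℝ)) ^ 5 = (r : ℝ) ^ 3 := by
      rw [← Real.rpow_natCast, ← Real.rpow_mul (by positivity), ← Real.rpow_natCast]
      norm_num
    have hy0 : 0 < (r : ℝ) ^ (3 / 5 : ℝ) := by positivity
    have hle : (r : ℝ) ^ (3 / 5 : ℝ) ≤ 2480 ^ 3 * m := by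
      refine le_of_pow_le_pow_left₀ (by norm_num : (5 : ℕ) ≠ 0) (by positivity) ?_
      rw [hy5, mul_pow]
      refine h5.trans (mul_le_mul_of_nonneg_right (by norm_num) (by positivity))
    linarith
  · exact lt_of_le_of_lt (by exact_mod_cast Nat.sInf_le hk) hlt
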